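/- Let $n\ge 1$, $G=GL(n)$ over $\mathbb{C}$, with standard basis $e_1,\dots,e_n$ of $\mathbb{C}^n$, and let $\mathcal{B}_n$ be the set of full flags in $\mathbb{C}^n$, on which $G$ acts. For linearly independent $v_1,\dots,v_n$ write $(v_1\subset v_2\subset\dots\subset v_n)$ for the flag whose $k$-th space is $\mathrm{span}\{v_1,\dots,v_k\}$. Let $B$ be the group of invertible upper triangular matrices, $\mathcal{E}_+=(e_1\subset\dots\subset e_n)$, $\mathcal{E}^*=(e_n\subset e_1\subset\dots\subset e_{n-1})$, $B^*$ the stabilizer of $\mathcal{E}^*$ in $G$, and $B_{n-1}$ the group of invertible upper triangular matrices of $GL(n-1)$, embedded in the upper left corner of $G$ by $A\mapsto \mathrm{diag}(A,1)$. Identify the Weyl group $W$ of $G$ with the symmetric group $\mathcal{S}_n$, acting by permutation matrices $e_j\mapsto e_{w(j)}$, and write $w(\mathcal{F})$ for the image of a flag $\mathcal{F}$ under $w\in W$. For $j\le n-1$ put $\hat{e}_j=e_j+e_n$. A flag is in standard form if it can be written as $(v_1\subset\dots\subset v_n)$, where each $v_i$ is some $e_j$ or some $\hat{e}_j$, such that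 (a) $v_i=e_n$ for some $i$; (b) if $v_i=e_n$, then $v_k$ is a standard basis vector for all $k>i$; (c) if $i<k$, $v_i=\hat{e}_j$ and $v_k=\hat{e}_{j'}$, then $j>j'$. Theorem 1.1. (1) If $\mathcal{F}$ is a flag in standard form, then $B_{n-1}\cdot\mathcal{F}=B\cdot\mathcal{F}\cap B^*\cdot\mathcal{F}$. (2) The $B_{n-1}$-orbits on $\mathcal{B}_n$ are exactly the nonempty intersections of a $B$-orbit with a $B^*$-orbit. (3) For every $B_{n-1}$-orbit $Q$ on $\mathcal{B}_n$ there is exactly one pair $(w,u^*)\in W\times W$ with $B\cdot Q=B\cdot w(\mathcal{E}_+)$ and $B^*\cdot Q=B^*\cdot u^*(\mathcal{E}^*)$, and for this pair $Q=B\cdot w(\mathcal{E}_+)\cap B^*\cdot u^*(\mathcal{E}^*)$. The Shareshian map $\mathcal{S}h: Q\mapsto(w,u^*)$ is a bijection from the set $B_{n-1}\backslash\mathcal{B}_n$ of $B_{n-1}$-orbits onto the set of all pairs $(w,u^*)\in W\times W$ for which $B\cdot w(\mathcal{E}_+)\cap B^*\cdot u^*(\mathcal{E}^*)$ is nonempty.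 -/

import Mathlib

open scoped Pointwise MatrixGroups

namespace Shareshian

/-- A full flag `0 = V₀ ⊂ V₁ ⊂ ⋯ ⊂ Vₙ = ℂⁿ` with `dim Vᵢ = i`; these are the points of the flag
variety of `GL(n)`. -/
@[ext]
structure FullFlag (n : ℕ) where
  space : Fin (n + 1) → Submodule ℂ (Fin n → ℂ)
  mono : Monotone space
  finrank_eq : ∀ k, Module.finrank ℂ (space k) = (k : ℕ)

/-- `F = (v₁ ⊂ v₂ ⊂ ⋯ ⊂ vₙ)`, that is, `V_k = span {v₁, …, v_k}` for all `k`. -/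
def FullFlag.IsSpannedBy {n : ℕ} (F : FullFlag n) (v : Fin n → (Fin n → ℂ)) : Prop :=
  ∀ k : Fin (n + 1), F.space k = Submodule.span ℂ (v '' {i | i.castSucc < k})

/-- The flag `(v₁ ⊂ v₂ ⊂ ⋯ ⊂ vₙ)` for linearly independent `v₁, …, vₙ`. -/
def FullFlag.ofLinearIndependent {n : ℕ} (v : Fin n → (Fin n → ℂ))
    (hv : LinearIndependent ℂ v) : FullFlag n where
  space k := Submodule.span ℂ (v '' {i | i.castSucc < k})
  mono _ _ hab := Submodule.span_mono (Set.image_mono fun _ hi => lt_of_lt_of_le hi hab)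
  finrank_eq k := by
    classical
    have h := finrank_span_eq_card
      (hv.comp (Subtype.val : {i : Fin n // i.castSucc < k} → Fin n) Subtype.val_injective)
    have hr : Set.range (v ∘ (Subtype.val : {i : Fin n // i.castSucc < k} → Fin n))
        = v '' {i | i.castSucc < k} := by
      rw [Set.range_comp, Subtype.range_coe_subtype]
    rw [hr] at h
    rw [h, Fintype.card_subtype]
    have : (Finset.univ.filter fun i : Fin n => i.castSucc < k)
        = Finset.univ.filter fun i : Fin n => (i : ℕ) < (k : ℕ) := by
      ext i; simp [Fin.lt_def]
    rw [this, Fin.card_filter_val_lt]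
    have := k.2
    omega

/-- The action of `GL(n)` on full flags, `g · (Vᵢ)ᵢ = (g Vᵢ)ᵢ`. -/
instance (n : ℕ) : MulAction (GL (Fin n) ℂ) (FullFlag n) where
  smul g F :=
    { space := fun k => (F.space k).map (Matrix.mulVecLin g.val)
      mono := fun _ _ hab => Submodule.map_mono (F.mono hab)
      finrank_eq := fun k => by
        rw [← F.finrank_eq k]
        exact (Submodule.equivMapOfInjective _
          (Matrix.mulVec_injective_of_isUnit g.isUnit) (F.space k)).finrank_eq.symm }
  one_smul F := by
    apply FullFlag.ext
    funext k
    change (F.space k).map (Matrix.mulVecLin (1 : Matrix (Fin n) (Fin n) ℂ)) = F.space k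
    rw [Matrix.mulVecLin_one, Submodule.map_id]
  mul_smul g h F := by
    apply FullFlag.ext
    funext k
    change (F.space k).map (Matrix.mulVecLin (g.val * h.val))
      = ((F.space k).map (Matrix.mulVecLin h.val)).map (Matrix.mulVecLin g.val)
    rw [Matrix.mulVecLin_mul, Submodule.map_comp]

/-- The group of invertible upper triangular `n × n` matrices. -/
def upperTriangular (n : ℕ) : Subgroup (GL (Fin n) ℂ) where
  carrier := {g | g.val.IsUpperTriangular}
  one_mem' := Matrix.blockTriangular_one
  mul_mem' ha hb := Matrix.BlockTriangular.mul ha hb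
  inv_mem' {g} hg := by
    have : Invertible g.val := g.invertible
    have h := Matrix.blockTriangular_inv_of_blockTriangular (M := g.val) hg
    simpa using h

/-- The embedding `A ↦ diag(A, 1)` of `GL(m)` in the top left hand corner of `GL(m + 1)`. -/
def cornerEmbedding (m : ℕ) : GL (Fin m) ℂ →* GL (Fin (m + 1)) ℂ :=
  Units.map
    { toFun := fun A => Matrix.reindex finSumFinEquiv finSumFinEquiv
        (Matrix.fromBlocks A 0 0 (1 : Matrix (Fin 1) (Fin 1) ℂ))
      map_one' := by simp
      map_mul' := fun A A' => by
        simp [Matrix.submatrix_mul_equiv, Matrix.fromBlocks_multiply] }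

/-- The standard basis vector `e_j`. -/
def e {n : ℕ} (j : Fin n) : Fin n → ℂ := Pi.single j 1

/-- The hat vector `ê_j = e_j + e_n` of index `j ≤ n - 1`, where `n = m + 1`. -/
def hat {m : ℕ} (j : Fin m) : Fin (m + 1) → ℂ := e j.castSucc + e (Fin.last m)

theorem linearIndependent_e (n : ℕ) : LinearIndependent ℂ (e : Fin n → (Fin n → ℂ)) := by
  have h := (Pi.basisFun ℂ (Fin n)).linearIndependent
  have : (e : Fin n → (Fin n → ℂ)) = ⇑(Pi.basisFun ℂ (Fin n)) := by
    funext j; simp [e]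
  rwa [this]

/-- The standard flag `(e₁ ⊂ e₂ ⊂ ⋯ ⊂ eₙ)`. -/
def standardFlag (n : ℕ) : FullFlag n := .ofLinearIndependent e (linearIndependent_e n)

/-- The sequence of vectors `eₙ, e₁, …, eₙ₋₁`, where `n = m + 1`. -/
def starVectors (m : ℕ) : Fin (m + 1) → (Fin (m + 1) → ℂ) :=
  Fin.cons (e (Fin.last m)) fun i => e i.castSucc

theorem linearIndependent_starVectors (m : ℕ) : LinearIndependent ℂ (starVectors m) := by
  have h : starVectors m = e ∘ (finRotate (m + 1)).symm := by
    funext i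
    rw [Function.comp_apply]
    refine Fin.cases ?_ (fun j => ?_) i
    · have : (finRotate (m + 1)).symm 0 = Fin.last m := by
        rw [Equiv.symm_apply_eq, finRotate_last]
      simp [starVectors, this]
    · have : (finRotate (m + 1)).symm j.succ = j.castSucc := by
        rw [Equiv.symm_apply_eq, finRotate_apply, Fin.coeSucc_eq_succ]
      simp [starVectors, this]
  rw [h]
  exact (linearIndependent_e (m + 1)).comp _ (Equiv.injective _)

/-- The flag `(eₙ ⊂ e₁ ⊂ ⋯ ⊂ eₙ₋₁)`, where `n = m + 1`. -/
def starFlag (m : ℕ) : FullFlag (m + 1) :=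
  .ofLinearIndependent (starVectors m) (linearIndependent_starVectors m)

/-- The Borel subgroup `B` of `GL(m + 1)`. -/
def B (m : ℕ) : Subgroup (GL (Fin (m + 1)) ℂ) := upperTriangular (m + 1)

/-- The Borel subgroup `B*` of `GL(m + 1)`. -/
def BStar (m : ℕ) : Subgroup (GL (Fin (m + 1)) ℂ) := MulAction.stabilizer _ (starFlag m)

/-- The Borel subgroup of upper triangular matrices of `GL(m)`, inside `GL(m + 1)`. -/
def BCorner (m : ℕ) : Subgroup (GL (Fin (m + 1)) ℂ) := (upperTriangular m).map (cornerEmbedding m)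

/-- The Weyl group of `GL(n)` is identified with the symmetric group; `w` acts on `ℂⁿ` through its
permutation matrix, `e_j ↦ e_{w j}`. -/
def permGL {n : ℕ} (w : Equiv.Perm (Fin n)) : GL (Fin n) ℂ where
  val := Matrix.of fun i j => if i = w j then 1 else 0
  inv := Matrix.of fun i j => if i = w.symm j then 1 else 0
  val_inv := by
    ext i j
    simp [Matrix.mul_apply, Matrix.one_apply]
  inv_val := by
    ext i j
    simp [Matrix.mul_apply, Matrix.one_apply]

/-- Flags in standard form. -/
def IsStandardForm {m : ℕ} (F : FullFlag (m + 1)) : Prop :=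
  ∃ v : Fin (m + 1) → (Fin (m + 1) → ℂ), F.IsSpannedBy v ∧
    (∀ i, (∃ j, v i = e j) ∨ ∃ j, v i = hat j) ∧
    (∃ i, v i = e (Fin.last m)) ∧
    (∀ i, v i = e (Fin.last m) → ∀ k, i < k → ∃ j, v k = e j) ∧
    (∀ i k j j', i < k → v i = hat j → v k = hat j' → j' < j)

/-- The set `B_{n-1} \ 𝓑_n` of `B_{n-1}`-orbits on the flag variety, where `n = m + 1`. -/
abbrev Orbits (m : ℕ) : Type := MulAction.orbitRel.Quotient (BCorner m) (FullFlag (m + 1))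

/-- The `B`-orbit through `w(E₊)`. -/
def schubertCell {m : ℕ} (w : Equiv.Perm (Fin (m + 1))) : Set (FullFlag (m + 1)) :=
  MulAction.orbit (B m) (permGL w • standardFlag (m + 1))

/-- The `B*`-orbit through `u(E*)`. -/
def starCell {m : ℕ} (u : Equiv.Perm (Fin (m + 1))) : Set (FullFlag (m + 1)) :=
  MulAction.orbit (BStar m) (permGL u • starFlag m)

end Shareshian

open Shareshian

namespace Shareshian
open Matrix

/-! ### Flags, the standard flag and its stabilizer. -/

variable {n : ℕ}

/-! Everything rests on `orbit_BCorner_eq`. Since `BCorner` lies in both `B` and `BStar`, the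
content is that two flags related by `B` and also by `BStar` are related by `BCorner`.

Each `BStar`-orbit contains some σ(E₊). By `exists_smul_hatFlag_eq`, `BCorner` moves any flag of
that orbit to the normal form obtained from σ(E₊) by putting hats on an admissible set T of indices.
By `subset_of_smul_hatFlag_eq`, applied in both directions, two normal forms with the same σ in one
`B`-orbit have the same T. So both flags have the same normal form.

The Bruhat decomposition, and its conjugate for `BStar`, labels the two kinds of orbits by unique
permutations; an orbit of `BCorner` is then recovered from its two labels as an intersection. -/

theorem FullFlag.mulVec_mem_smul {g : GL (Fin n) ℂ} {F : FullFlag n} {k : Fin (n + 1)}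
    {x : Fin n → ℂ} (hx : x ∈ F.space k) : g.val *ᵥ x ∈ (g • F).space k :=
  ⟨x, hx, rfl⟩

theorem FullFlag.mem_smul_iff {g : GL (Fin n) ℂ} {F : FullFlag n} {k : Fin (n + 1)}
    {x : Fin n → ℂ} : x ∈ (g • F).space k ↔ g⁻¹.val *ᵥ x ∈ F.space k := by
  constructor
  · intro h
    simpa using FullFlag.mulVec_mem_smul (g := g⁻¹) h
  · intro h
    have := FullFlag.mulVec_mem_smul (g := g) h
    rwa [mulVec_mulVec, ← Units.val_mul, mul_inv_cancel, Units.val_one, one_mulVec] at this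

theorem FullFlag.eq_of_le {F F' : FullFlag n} (h : ∀ k, F.space k ≤ F'.space k) : F = F' :=
  FullFlag.ext <| funext fun k =>
    Submodule.eq_of_le_of_finrank_eq (h k) ((F.finrank_eq k).trans (F'.finrank_eq k).symm)

theorem FullFlag.eq_of_mem {F F' : FullFlag n} {v : Fin n → Fin n → ℂ}
    (hv : LinearIndependent ℂ v) (h : ∀ i, v i ∈ F.space i.succ) (h' : ∀ i, v i ∈ F'.space i.succ) :
    F = F' := by
  have key : ∀ F : FullFlag n, (∀ i, v i ∈ F.space i.succ) → .ofLinearIndependent v hv = F := by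
    intro F h
    refine FullFlag.eq_of_le fun k => Submodule.span_le.2 ?_
    rintro _ ⟨i, hi, rfl⟩
    exact F.mono (Fin.castSucc_lt_iff_succ_le.1 hi) (h i)
  rw [← key F h, ← key F' h']

theorem e_mem_standardFlag (i : Fin n) : e i ∈ (standardFlag n).space i.succ :=
  Submodule.subset_span ⟨i, Fin.castSucc_lt_succ, rfl⟩

theorem mulVec_e (M : Matrix (Fin n) (Fin n) ℂ) (j i : Fin n) : (M *ᵥ e j) i = M i j := by
  simp [e]

theorem eq_sum_e (x : Fin n → ℂ) : x = ∑ i, x i • e i := by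
  ext j; simp [e, Finset.sum_apply, Pi.single_apply]

theorem mem_standardFlag {x : Fin n → ℂ} {k : Fin (n + 1)} :
    x ∈ (standardFlag n).space k ↔ ∀ i : Fin n, k ≤ i.castSucc → x i = 0 := by
  constructor
  · intro hx i hi
    have : (standardFlag n).space k ≤ LinearMap.ker (LinearMap.proj i : (Fin n → ℂ) →ₗ[ℂ] ℂ) := by
      refine Submodule.span_le.2 ?_
      rintro _ ⟨j, hj, rfl⟩
      have hij : j ≠ i := by
        rintro rfl
        exact absurd hi (not_le.2 hj)
      simp [e, hij.symm]
    exact this hx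
  · intro h
    rw [eq_sum_e x]
    refine Submodule.sum_mem _ fun i _ => ?_
    by_cases hi : k ≤ i.castSucc
    · simp [h i hi]
    · exact Submodule.smul_mem _ _ (Submodule.subset_span ⟨i, not_le.1 hi, rfl⟩)

theorem smul_standardFlag_eq {g : GL (Fin n) ℂ} {F : FullFlag n}
    (h : ∀ i, g.val *ᵥ e i ∈ F.space i.succ) : g • standardFlag n = F := by
  have : standardFlag n = g⁻¹ • F := by
    refine FullFlag.eq_of_mem (linearIndependent_e n) e_mem_standardFlag fun i => ?_
    simpa [FullFlag.mem_smul_iff] using h i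
  rw [this, smul_inv_smul]

theorem mem_upperTriangular {g : GL (Fin n) ℂ} :
    g ∈ upperTriangular n ↔ ∀ i j, j < i → g.val i j = 0 :=
  Iff.rfl

theorem smul_standardFlag_eq_self_iff {g : GL (Fin n) ℂ} :
    g • standardFlag n = standardFlag n ↔ g ∈ upperTriangular n := by
  constructor
  · intro h i j hij
    have := FullFlag.mulVec_mem_smul (g := g) (e_mem_standardFlag j)
    rw [h, mem_standardFlag] at this
    simpa [mulVec_e] using this i (Fin.succ_le_castSucc_iff.2 hij)
  · intro h
    refine smul_standardFlag_eq fun i => mem_standardFlag.2 fun j hj => ?_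
    rw [mulVec_e]
    exact h (Fin.succ_le_castSucc_iff.1 hj)

theorem upperTriangular_apply_self_ne_zero {g : GL (Fin n) ℂ} (hg : g ∈ upperTriangular n)
    (i : Fin n) : g.val i i ≠ 0 := by
  have h : g.val.det ≠ 0 := ((Matrix.isUnit_iff_isUnit_det _).1 g.isUnit).ne_zero
  rw [Matrix.det_of_isUpperTriangular hg, Finset.prod_ne_zero_iff] at h
  exact h i (Finset.mem_univ i)

/-- A family of columns with nonzero diagonal that vanishes below the diagonal is the family of
columns of an element of the group of upper triangular matrices. -/
theorem exists_upperTriangular_mulVec_e {x : Fin n → Fin n → ℂ} (h : ∀ i j, j < i → x j i = 0)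
    (h' : ∀ j, x j j ≠ 0) : ∃ g ∈ upperTriangular n, ∀ j, g.val *ᵥ e j = x j := by
  let M : Matrix (Fin n) (Fin n) ℂ := Matrix.of fun i j => x j i
  have hM : M.IsUpperTriangular := fun i j hij => h i j hij
  have hdet : M.det ≠ 0 := by
    rw [Matrix.det_of_isUpperTriangular hM]
    exact Finset.prod_ne_zero_iff.2 fun j _ => h' j
  refine ⟨Matrix.GeneralLinearGroup.mkOfDetNeZero M hdet, hM, fun j => ?_⟩
  ext i
  rw [mulVec_e]
  rfl

theorem permGL_mulVec_e (w : Equiv.Perm (Fin n)) (j : Fin n) :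
    (permGL w).val *ᵥ e j = e (w j) := by
  ext i
  rw [mulVec_e]
  simp [permGL, e, Pi.single_apply]

theorem permGL_mul (w w' : Equiv.Perm (Fin n)) : permGL (w * w') = permGL w * permGL w' := by
  ext i j
  simp [permGL, Matrix.mul_apply]
  congr

theorem permGL_one : permGL (1 : Equiv.Perm (Fin n)) = 1 := by
  ext i j
  simp [permGL, Matrix.one_apply]
  congr

theorem permGL_inv (w : Equiv.Perm (Fin n)) : permGL w⁻¹ = (permGL w)⁻¹ := by
  rw [eq_inv_iff_mul_eq_one, ← permGL_mul, inv_mul_cancel, permGL_one]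

/-! ### Bruhat decomposition of the flag variety. -/

theorem exists_pivot {v : Fin n → ℂ} (hv : v ≠ 0) : ∃ p, v p ≠ 0 ∧ ∀ i, p < i → v i = 0 := by
  obtain ⟨j, hj⟩ := Function.ne_iff.1 hv
  have hne : (Finset.univ.filter fun i => v i ≠ 0).Nonempty := ⟨j, by simpa using hj⟩
  refine ⟨_, (Finset.mem_filter.1 (Finset.max'_mem _ hne)).2, fun i hi => ?_⟩
  by_contra h
  exact absurd (Finset.le_max' _ i (by simpa using h)) (not_le.2 hi)

theorem FullFlag.exists_mem_notMem (F : FullFlag n) (k : Fin n) :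
    ∃ v ∈ F.space k.succ, v ∉ F.space k.castSucc := by
  by_contra! h
  have := Submodule.finrank_mono h
  rw [F.finrank_eq, F.finrank_eq] at this
  simp at this

/-- Existence in the Bruhat decomposition of the flag variety. -/
theorem exists_bruhat (F : FullFlag n) :
    ∃ w : Equiv.Perm (Fin n), ∃ b ∈ upperTriangular n, b • permGL w • standardFlag n = F := by
  -- The pivot of a vector is its last nonzero coordinate. The permutation sends `k` to the least
  -- pivot among the vectors that enter the flag at step `k`.
  let P : Fin n → Fin n → Prop := fun k p =>
    ∃ v ∈ F.space k.succ, v ∉ F.space k.castSucc ∧ v p ≠ 0 ∧ ∀ i, p < i → v i = 0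
  have hP : ∀ k, ∃ p, P k p ∧ ∀ q, P k q → p ≤ q := by
    intro k
    have hne : {p | P k p}.Nonempty := by
      obtain ⟨v, hv, hv'⟩ := F.exists_mem_notMem k
      obtain ⟨p, hp, hp'⟩ := exists_pivot (v := v) (by rintro rfl; exact hv' (zero_mem _))
      exact ⟨p, v, hv, hv', hp, hp'⟩
    obtain ⟨p, hp, hp'⟩ := WellFounded.has_min (wellFounded_lt (α := Fin n)) _ hne
    exact ⟨p, hp, fun q hq => not_lt.1 (hp' q hq)⟩
  choose w hw hmin using hP
  choose v hv hv' hpiv hzero using hw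
  have hlt : ∀ i k, i < k → w i ≠ w k := by
    intro i k hik heq
    -- If two pivots agreed, cancelling the common one would give a vector entering at step `k` with
    -- a smaller pivot.
    set u := v k - (v k (w k) / v i (w k)) • v i with hu
    have hvi : v i ∈ F.space k.castSucc := F.mono (Fin.succ_le_castSucc_iff.2 hik) (hv i)
    have hu1 : u ∈ F.space k.succ := Submodule.sub_mem _ (hv k)
      (Submodule.smul_mem _ _ (F.mono Fin.castSucc_lt_succ.le hvi))
    have hu2 : u ∉ F.space k.castSucc := fun h =>
      hv' k ((Submodule.sub_mem_iff_left _ (Submodule.smul_mem _ _ hvi)).1 h)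
    obtain ⟨q, hq, hq'⟩ := exists_pivot (v := u) (by intro h; rw [h] at hu2; exact hu2 (zero_mem _))
    have hle := hmin k q ⟨u, hu1, hu2, hq, hq'⟩
    apply hq
    have hne : v i (w k) ≠ 0 := heq ▸ hpiv i
    rcases hle.eq_or_lt with rfl | hlt
    · simp [hu, hne]
    · simp [hu, hzero k q hlt, hzero i q (heq ▸ hlt)]
  have hinj : Function.Injective w := by
    intro i k h
    by_contra hik
    rcases lt_or_gt_of_ne hik with h1 | h1
    · exact hlt _ _ h1 h
    · exact hlt _ _ h1 h.symm
  let σ : Equiv.Perm (Fin n) := Equiv.ofBijective w (Finite.injective_iff_bijective.1 hinj)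
  have hσ : ∀ i, σ i = w i := fun _ => rfl
  obtain ⟨b, hb, hbe⟩ := exists_upperTriangular_mulVec_e (x := fun j => v (σ.symm j))
    (fun i j hij => hzero _ _ (by rwa [← hσ, Equiv.apply_symm_apply]))
    (fun j => by
      have := hpiv (σ.symm j)
      rwa [← hσ, Equiv.apply_symm_apply] at this)
  refine ⟨σ, b, hb, ?_⟩
  rw [smul_smul]
  refine smul_standardFlag_eq fun i => ?_
  rw [Units.val_mul, ← mulVec_mulVec, permGL_mulVec_e, hbe, Equiv.symm_apply_apply]
  exact hv i

/-- Uniqueness in the Bruhat decomposition of the flag variety. -/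
theorem bruhat_unique {w w' : Equiv.Perm (Fin n)} {b : GL (Fin n) ℂ} (hb : b ∈ upperTriangular n)
    (h : b • permGL w • standardFlag n = permGL w' • standardFlag n) : w = w' := by
  -- The coordinate of `b e_{w k}` at `w k` is a diagonal entry of `b`, hence nonzero, so `e_{w k}`
  -- must occur in `w'(E₊)` by step `k`. A permutation that never increases an index is the
  -- identity.
  have hle : ∀ k, w'.symm (w k) ≤ k := by
    intro k
    have hk := FullFlag.mulVec_mem_smul (g := b)
      (FullFlag.mulVec_mem_smul (g := permGL w) (e_mem_standardFlag k))
    rw [h, FullFlag.mem_smul_iff, mem_standardFlag, permGL_mulVec_e, ← permGL_inv] at hk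
    by_contra! hlt
    have h0 := hk (w'.symm (w k)) (Fin.succ_le_castSucc_iff.2 hlt)
    have : ((permGL w'⁻¹).val *ᵥ (b.val *ᵥ e (w k))) (w'.symm (w k)) = b.val (w k) (w k) := by
      have hx : ∀ x : Fin n → ℂ, ((permGL w'⁻¹).val *ᵥ x) (w'.symm (w k)) = x (w k) := by
        intro x
        simp [permGL, Matrix.mulVec, dotProduct]
      rw [hx, mulVec_e]
    rw [this] at h0
    exact upperTriangular_apply_self_ne_zero hb _ h0
  have hid : ∀ k, w'.symm (w k) = k := by
    intro k
    induction k using WellFoundedLT.induction with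
    | _ k ih =>
      refine (hle k).eq_of_not_lt fun hlt => ?_
      have := ih _ hlt
      exact hlt.ne (w.injective (w'.symm.injective this))
  exact Equiv.ext fun k => w'.symm_apply_eq.1 (hid k)

/-! ### The Borel subgroup `BStar` and its cells. -/

variable {m : ℕ}

/-- The permutation taking the sequence `e₁, …, eₙ` to `eₙ, e₁, …, eₙ₋₁`. -/
def starPerm (m : ℕ) : Equiv.Perm (Fin (m + 1)) := (finRotate (m + 1)).symm

@[simp]
theorem starPerm_zero : starPerm m 0 = Fin.last m := by
  rw [starPerm, Equiv.symm_apply_eq, finRotate_last]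

@[simp]
theorem starPerm_succ (i : Fin m) : starPerm m i.succ = i.castSucc := by
  rw [starPerm, Equiv.symm_apply_eq, finRotate_apply, Fin.coeSucc_eq_succ]

theorem starFlag_eq : starFlag m = permGL (starPerm m) • standardFlag (m + 1) := by
  refine (smul_standardFlag_eq fun i => ?_).symm
  rw [permGL_mulVec_e]
  refine Submodule.subset_span ⟨i, Fin.castSucc_lt_succ, ?_⟩
  refine Fin.cases ?_ (fun j => ?_) i <;> simp [starVectors]

/-- E* is the image of E₊ under the cycle `starPerm`, so its stabilizer is the conjugate of the
upper triangular group. -/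
theorem mem_BStar_iff_conj {b : GL (Fin (m + 1)) ℂ} :
    b ∈ BStar m ↔ (permGL (starPerm m))⁻¹ * b * permGL (starPerm m) ∈ upperTriangular (m + 1) := by
  rw [← smul_standardFlag_eq_self_iff, mul_smul, ← starFlag_eq, mul_smul, inv_smul_eq_iff,
    ← starFlag_eq]
  rfl

/-- The last row is unconstrained; its entries are the source of the hats. -/
theorem mem_BStar_iff {b : GL (Fin (m + 1)) ℂ} :
    b ∈ BStar m ↔ (∀ i j : Fin m, j < i → b.val i.castSucc j.castSucc = 0) ∧
      ∀ i : Fin m, b.val i.castSucc (Fin.last m) = 0 := by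
  have key : ∀ i j, ((permGL (starPerm m))⁻¹ * b * permGL (starPerm m)).val i j
      = b.val (starPerm m i) (starPerm m j) := by
    intro i j
    rw [← permGL_inv]
    simp [permGL, Matrix.mul_apply, Units.val_mul, Equiv.eq_symm_apply]
  rw [mem_BStar_iff_conj, mem_upperTriangular]
  simp only [key]
  simp [Fin.forall_fin_succ, forall_and, and_comm]

theorem BStar_apply_self_ne_zero {b : GL (Fin (m + 1)) ℂ} (hb : b ∈ BStar m) (i : Fin (m + 1)) :
    b.val i i ≠ 0 := by
  have := upperTriangular_apply_self_ne_zero (mem_BStar_iff_conj.1 hb) ((starPerm m).symm i)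
  rw [← permGL_inv] at this
  simpa [permGL, Matrix.mul_apply, Units.val_mul] using this

theorem starCell_eq (u : Equiv.Perm (Fin (m + 1))) :
    starCell u = MulAction.orbit (BStar m) (permGL (u * starPerm m) • standardFlag (m + 1)) := by
  rw [starCell, starFlag_eq, smul_smul, permGL_mul]

theorem existsUnique_schubertCell (F : FullFlag (m + 1)) :
    ∃! w, MulAction.orbit (B m) F = schubertCell w := by
  obtain ⟨w, b, hb, h⟩ := exists_bruhat F
  refine ⟨w, MulAction.orbit_eq_iff.2 ⟨⟨b, hb⟩, h⟩, fun w' h' => ?_⟩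
  obtain ⟨b', hb'⟩ := MulAction.orbit_eq_iff.1 h'
  refine (bruhat_unique (b := (b'⁻¹).1 * b) (mul_mem (b'⁻¹).2 hb) ?_).symm
  rw [mul_smul, h, ← hb']
  exact inv_smul_smul b' _

/-- The Bruhat decomposition of `c⁻¹ • F`, carried back by `c`; the labels correspond by conjugation
with `starPerm`. -/
theorem existsUnique_starCell (F : FullFlag (m + 1)) :
    ∃! u, MulAction.orbit (BStar m) F = starCell u := by
  set c := permGL (starPerm m) with hc
  obtain ⟨w, b, hb, h⟩ := exists_bruhat (c⁻¹ • F)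
  have hmem : ∀ b ∈ upperTriangular (m + 1), c * b * c⁻¹ ∈ BStar m := by
    intro b hb
    rw [mem_BStar_iff_conj]
    simpa [← hc, mul_assoc] using hb
  have hperm : ∀ u : Equiv.Perm (Fin (m + 1)),
      permGL u • starFlag m = c • permGL ((starPerm m)⁻¹ * u * starPerm m) • standardFlag (m + 1) := by
    intro u
    simp only [starFlag_eq, permGL_mul, permGL_inv, ← hc, smul_smul]
    simp [mul_assoc]
  refine ⟨starPerm m * w * (starPerm m)⁻¹, MulAction.orbit_eq_iff.2
    ⟨⟨c * b * c⁻¹, hmem b hb⟩, ?_⟩, fun u hu => ?_⟩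
  · change (c * b * c⁻¹) • permGL _ • starFlag m = F
    rw [hperm, ← smul_left_cancel_iff c⁻¹, ← h, smul_smul, smul_smul]
    simp [mul_assoc, smul_smul]
  · obtain ⟨b', hb'⟩ := MulAction.orbit_eq_iff.1 hu
    have h2 : w = (starPerm m)⁻¹ * u * starPerm m := by
      refine bruhat_unique (b := (c⁻¹ * (b'⁻¹).1 * c) * b)
        (mul_mem (mem_BStar_iff_conj.1 (b'⁻¹).2) hb) ?_
      have h3 : F = b'.1 • permGL u • starFlag m := hb'.symm
      rw [mul_smul, h, h3, hperm]
      simp [smul_smul, mul_assoc]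
    rw [h2]
    group

/-! ### The corner subgroup. -/

theorem cornerEmbedding_mulVec_castSucc (A : GL (Fin m) ℂ) (j : Fin m) :
    (cornerEmbedding m A).val *ᵥ e j.castSucc = Fin.snoc (α := fun _ => ℂ) (A.val *ᵥ e j) 0 := by
  ext i
  rw [mulVec_e]
  refine Fin.lastCases ?_ (fun i => ?_) i <;>
  simp [cornerEmbedding, mulVec_e]

theorem cornerEmbedding_mulVec_last (A : GL (Fin m) ℂ) :
    (cornerEmbedding m A).val *ᵥ e (Fin.last m) = e (Fin.last m) := by
  ext i
  rw [mulVec_e]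
  refine Fin.lastCases ?_ (fun i => ?_) i <;>
  simp [cornerEmbedding, e]

theorem BCorner_le_B : BCorner m ≤ B m := by
  rintro _ ⟨A, hA, rfl⟩ i j hij
  rw [← mulVec_e (cornerEmbedding m A).val]
  refine Fin.lastCases (fun hij => ?_) (fun j hij => ?_) j hij
  · exact absurd hij (not_lt.2 (Fin.le_last i))
  · rw [cornerEmbedding_mulVec_castSucc]
    refine Fin.lastCases (fun _ => ?_) (fun i hij => ?_) i hij
    · simp
    · simpa [mulVec_e] using hA (Fin.castSucc_lt_castSucc_iff.1 hij)

theorem BCorner_le_BStar : BCorner m ≤ BStar m := by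
  rintro _ ⟨A, hA, rfl⟩
  rw [mem_BStar_iff]
  refine ⟨fun i j hij => ?_, fun i => ?_⟩
  · rw [← mulVec_e (cornerEmbedding m A).val, cornerEmbedding_mulVec_castSucc]
    simpa [mulVec_e] using hA hij
  · rw [← mulVec_e (cornerEmbedding m A).val, cornerEmbedding_mulVec_last]
    simp [e]

theorem exists_BCorner_mulVec_e {x : Fin m → Fin (m + 1) → ℂ}
    (h : ∀ i j, j.castSucc < i → x j i = 0) (h' : ∀ j, x j j.castSucc ≠ 0) :
    ∃ g ∈ BCorner m, (∀ j : Fin m, g.val *ᵥ e j.castSucc = x j) ∧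
      g.val *ᵥ e (Fin.last m) = e (Fin.last m) := by
  obtain ⟨A, hA, hAx⟩ := exists_upperTriangular_mulVec_e (x := fun j i => x j i.castSucc)
    (fun i j hij => h _ _ (Fin.castSucc_lt_castSucc_iff.2 hij)) h'
  refine ⟨_, ⟨A, hA, rfl⟩, fun j => ?_, cornerEmbedding_mulVec_last A⟩
  rw [cornerEmbedding_mulVec_castSucc, hAx]
  ext i
  refine Fin.lastCases ?_ (fun i => ?_) i
  · simp [h (Fin.last m) j (Fin.castSucc_lt_last j)]
  · simp

/-! ### Normal forms with hat vectors. -/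

/-- The unipotent matrix `e_j ↦ e_j + t_j e_n` for `j ≤ n - 1`, `e_n ↦ e_n`, where `n = m + 1`. -/
def hatGL (t : Fin m → ℂ) : GL (Fin (m + 1)) ℂ :=
  have key : ∀ t : Fin m → ℂ,
      (1 + vecMulVec (e (Fin.last m)) (Fin.snoc (α := fun _ => ℂ) t 0)) *
        (1 + vecMulVec (e (Fin.last m)) (Fin.snoc (α := fun _ => ℂ) (-t) 0)) = 1 := by
    intro t
    have h0 : Fin.snoc (α := fun _ => ℂ) t 0 ⬝ᵥ e (Fin.last m) = 0 := by simp [e]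
    have hneg : Fin.snoc (α := fun _ => ℂ) (-t) 0 = -Fin.snoc (α := fun _ => ℂ) t 0 := by
      ext i
      refine Fin.lastCases ?_ (fun i => ?_) i <;> simp
    rw [add_mul, mul_add, mul_add, vecMulVec_mul_vecMulVec, h0, hneg, vecMulVec_neg]
    simp
  { val := 1 + vecMulVec (e (Fin.last m)) (Fin.snoc (α := fun _ => ℂ) t 0)
    inv := 1 + vecMulVec (e (Fin.last m)) (Fin.snoc (α := fun _ => ℂ) (-t) 0)
    val_inv := key t
    inv_val := by simpa using key (-t) }

theorem hatGL_mulVec (t : Fin m → ℂ) (x : Fin (m + 1) → ℂ) :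
    (hatGL t).val *ᵥ x = x + (∑ j, t j * x j.castSucc) • e (Fin.last m) := by
  simp only [hatGL, add_mulVec, one_mulVec, vecMulVec_mulVec]
  rw [op_smul_eq_smul]
  simp [dotProduct, Fin.sum_univ_castSucc]

theorem hatGL_inv (t : Fin m → ℂ) : (hatGL t)⁻¹ = hatGL (-t) := by
  ext1
  rfl

/-- The flag spanned by the vectors `e_{σ k} + t_{σ k} e_n`, where `t_n = 0`. -/
def hatFlag (σ : Equiv.Perm (Fin (m + 1))) (t : Fin m → ℂ) : FullFlag (m + 1) :=
  hatGL t • permGL σ • standardFlag (m + 1)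

/-- Pull `x` back to the standard flag. The condition on the last coordinate is present only while
`eₙ` has not yet entered the flag. -/
theorem mem_hatFlag {σ : Equiv.Perm (Fin (m + 1))} {t : Fin m → ℂ} {k : Fin (m + 2)}
    {x : Fin (m + 1) → ℂ} : x ∈ (hatFlag σ t).space k ↔
      (∀ j : Fin m, k ≤ (σ.symm j.castSucc).castSucc → x j.castSucc = 0) ∧
      (k ≤ (σ.symm (Fin.last m)).castSucc → x (Fin.last m) = ∑ j, t j * x j.castSucc) := by
  have hσ : ∀ (y : Fin (m + 1) → ℂ) i, ((permGL σ)⁻¹.val *ᵥ y) i = y (σ i) := by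
    intro y i
    simp [permGL, Matrix.mulVec, dotProduct, Equiv.eq_symm_apply]
  rw [hatFlag, FullFlag.mem_smul_iff, FullFlag.mem_smul_iff, mem_standardFlag]
  simp only [hσ]
  rw [← σ.symm.forall_congr_right]
  simp only [Equiv.apply_symm_apply]
  rw [Fin.forall_fin_succ']
  rw [hatGL_inv, hatGL_mulVec]
  simp [e, ← sub_eq_add_neg, sub_eq_zero]

/-- The set `T` of indices of hat vectors of a flag in standard form, whose underlying permutation
is `σ`. -/
structure IsHatSet (σ : Equiv.Perm (Fin (m + 1))) (T : Set (Fin m)) : Prop where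
  lt_last : ∀ j ∈ T, σ.symm j.castSucc < σ.symm (Fin.last m)
  anti : ∀ i ∈ T, ∀ j ∈ T, σ.symm i.castSucc < σ.symm j.castSucc → j < i

/-- Suppose j is in T but not in T'. Then `e_j` enters the second flag at its position, so `x = b⁻¹
e_j` enters the first one there, and `x` is supported on indices at most j. The first flag requires
the last coordinate of `x`, which is 0, to be the sum of `x i` over T. Indices of T at earlier
positions exceed j, and later positions contribute 0, so `x j = 0`. Then `x` already lies in the
preceding space, a contradiction. -/
theorem subset_of_smul_hatFlag_eq {σ : Equiv.Perm (Fin (m + 1))} {T T' : Set (Fin m)}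
    (hT : IsHatSet σ T) {b : GL (Fin (m + 1)) ℂ} (hb : b ∈ B m)
    (h : b • hatFlag σ (T.indicator 1) = hatFlag σ (T'.indicator 1)) : T ⊆ T' := by
  intro j hj
  by_contra hj'
  set k := σ.symm j.castSucc with hk
  have hklast := hT.lt_last j hj
  set x := (b⁻¹).val *ᵥ e j.castSucc with hx
  have hsum : ∑ i, T'.indicator 1 i * (e j.castSucc : Fin (m + 1) → ℂ) i.castSucc = 0 := by
    refine Finset.sum_eq_zero fun i _ => ?_
    by_cases hij : i = j
    · subst hij; simp [hj']
    · simp [e, hij]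
  have h1 : x ∈ (hatFlag σ (T.indicator 1)).space k.succ := by
    rw [hx, ← FullFlag.mem_smul_iff, h, mem_hatFlag, hsum]
    refine ⟨fun i hi => ?_, fun _ => by simp [e]⟩
    have : i ≠ j := by
      rintro rfl
      exact absurd hi (not_le.2 Fin.castSucc_lt_succ)
    simp [e, this]
  have h2 : x ∉ (hatFlag σ (T.indicator 1)).space k.castSucc := by
    rw [hx, ← FullFlag.mem_smul_iff, h, mem_hatFlag]
    intro h3
    have := h3.1 j le_rfl
    simp [e] at this
  have h3 : ∀ i, j.castSucc < i → x i = 0 := by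
    intro i hi
    rw [hx, mulVec_e]
    exact (inv_mem hb) hi
  rw [mem_hatFlag] at h1 h2
  have hpos : ∀ i : Fin m, k < σ.symm i.castSucc → x i.castSucc = 0 := fun i hi =>
    h1.1 i (Fin.succ_le_castSucc_iff.2 hi)
  have h4 := h1.2 (Fin.succ_le_castSucc_iff.2 hklast)
  rw [h3 _ (Fin.castSucc_lt_last j), Finset.sum_eq_single j] at h4
  · have h5 : x j.castSucc = 0 := by simpa [hj] using h4.symm
    have hpos' : ∀ i : Fin m, k ≤ σ.symm i.castSucc → x i.castSucc = 0 := by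
      intro i hi
      rcases hi.eq_or_lt with hi | hi
      · have : j = i := by simpa [hk] using hi
        rwa [← this]
      · exact hpos i hi
    refine h2 ⟨fun i hi => hpos' i (Fin.castSucc_le_castSucc_iff.1 hi), fun _ => ?_⟩
    exact h1.2 (Fin.succ_le_castSucc_iff.2 hklast)
  · intro i _ hij
    by_cases hi : i ∈ T
    · rcases lt_trichotomy (σ.symm i.castSucc) k with hlt | heq | hlt
      · simp [h3 i.castSucc (Fin.castSucc_lt_castSucc_iff.2 (hT.anti i hi j hj hlt))]
      · exact absurd (by simpa [hk] using heq) hij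
      · simp [hpos i hlt]
    · simp [hi]
  · simp

/-- Every flag in the `B*`-orbit of `σ(E₊)` is conjugate under `B_{n-1}` to a flag in standard
form. -/
theorem exists_smul_hatFlag_eq (σ : Equiv.Perm (Fin (m + 1))) {b : GL (Fin (m + 1)) ℂ}
    (hb : b ∈ BStar m) : ∃ T, IsHatSet σ T ∧ ∃ h ∈ BCorner m,
      h • hatFlag σ (T.indicator 1) = b • permGL σ • standardFlag (m + 1) := by
  set F := b • permGL σ • standardFlag (m + 1) with hF
  set pos : Fin m → Fin (m + 1) := fun j => σ.symm j.castSucc with hpos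
  set top := σ.symm (Fin.last m) with htop
  set r : Fin m → ℂ := fun j => b.val (Fin.last m) j.castSucc with hr
  set y : Fin (m + 1) → Fin (m + 1) → ℂ := fun j => b.val *ᵥ e j with hy
  have hyF : ∀ j, y j ∈ F.space (σ.symm j).succ := by
    intro j
    refine FullFlag.mulVec_mem_smul ?_
    have := FullFlag.mulVec_mem_smul (g := permGL σ) (e_mem_standardFlag (σ.symm j))
    rwa [permGL_mulVec_e, Equiv.apply_symm_apply] at this
  have hmono : ∀ {i k : Fin (m + 1)}, i ≤ k → F.space i.succ ≤ F.space k.succ := fun h =>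
    F.mono (Fin.succ_le_succ_iff.2 h)
  obtain ⟨hb1, hb2⟩ := mem_BStar_iff.1 hb
  have hlast : e (Fin.last m) ∈ F.space top.succ := by
    have h1 : y (Fin.last m) = b.val (Fin.last m) (Fin.last m) • e (Fin.last m) := by
      ext i
      change (b.val *ᵥ e (Fin.last m)) i = _
      rw [mulVec_e]
      refine Fin.lastCases ?_ (fun i => ?_) i
      · simp [e]
      · simp [e, hb2]
    have h2 := hyF (Fin.last m)
    rw [h1] at h2
    exact (Submodule.smul_mem_iff _ (BStar_apply_self_ne_zero hb _)).1 h2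
  -- Deleting the last coordinate of the columns of `b` leaves columns of an element of `BCorner`.
  set p : Fin m → Fin (m + 1) → ℂ := fun j => y j.castSucc - r j • e (Fin.last m) with hp
  have hp0 : ∀ i (j : Fin m), j.castSucc < i → p j i = 0 := by
    intro i j
    refine Fin.lastCases (fun _ => ?_) (fun i hij => ?_) i
    · simp [hp, hy, hr, e]
    · simp [hp, hy, e, hb1 i j (Fin.castSucc_lt_castSucc_iff.1 hij)]
  have hpj : ∀ j : Fin m, p j j.castSucc ≠ 0 := by
    intro j
    simpa [hp, hy, mulVec_e, e] using BStar_apply_self_ne_zero hb j.castSucc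
  -- Among the positions before `eₙ` with `r j ≠ 0`, keep the successive record minima of the index.
  let T : Set (Fin m) :=
    {j | pos j < top ∧ r j ≠ 0 ∧ ∀ i, pos i < pos j → r i ≠ 0 → j < i}
  refine ⟨T, ⟨fun j hj => hj.1, fun i hi j hj hij => hj.2.2 i hij hi.2.1⟩, ?_⟩
  have hx : ∀ j : Fin m, ∃ x : Fin (m + 1) → ℂ, (∀ i, j.castSucc < i → x i = 0) ∧
      x j.castSucc ≠ 0 ∧
      x + (T.indicator 1 j : ℂ) • e (Fin.last m) ∈ F.space (pos j).succ := by
    intro j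
    -- At a record, rescaling makes the coefficient of `eₙ` equal to 1.
    by_cases hjT : j ∈ T
    · refine ⟨(r j)⁻¹ • p j, fun i hi => by simp [hp0 i j hi],
        by simpa [hpj j] using hjT.2.1, ?_⟩
      have : (r j)⁻¹ • p j + (T.indicator 1 j : ℂ) • e (Fin.last m) = (r j)⁻¹ • y j.castSucc := by
        simp [hp, hjT, smul_sub, smul_smul, inv_mul_cancel₀ hjT.2.1]
      rw [this]
      exact Submodule.smul_mem _ _ (hyF _)
    simp only [Set.indicator_of_notMem hjT, zero_smul, add_zero]
    by_cases hr0 : r j = 0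
    · refine ⟨p j, fun i hi => hp0 i j hi, hpj j, ?_⟩
      simpa [hp, hr0] using hyF j.castSucc
    by_cases hlt : pos j < top
    -- Off the records, an earlier vector of smaller index clears the `eₙ`-part without destroying
    -- triangularity.
    · obtain ⟨i, hij, hri, hle⟩ : ∃ i, pos i < pos j ∧ r i ≠ 0 ∧ i ≤ j := by
        by_contra! hcon
        exact hjT ⟨hlt, hr0, hcon⟩
      have hne : i < j := hle.lt_of_ne (by rintro rfl; exact hij.false)
      have hne' : i.castSucc < j.castSucc := Fin.castSucc_lt_castSucc_iff.2 hne
      refine ⟨p j - (r j / r i) • p i, fun l hl => ?_, ?_, ?_⟩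
      · simp [hp0 l j hl, hp0 l i (hne'.trans hl)]
      · simpa [hp0 _ i hne'] using hpj j
      · have : p j - (r j / r i) • p i = y j.castSucc - (r j / r i) • y i.castSucc := by
          simp [hp, smul_sub, smul_smul, div_mul_cancel₀ _ hri]
        rw [this]
        exact Submodule.sub_mem _ (hyF _) (Submodule.smul_mem _ _ (hmono hij.le (hyF _)))
    -- Here `eₙ` is already in the space, so its multiple can simply be removed.
    · exact ⟨p j, fun i hi => hp0 i j hi, hpj j, Submodule.sub_mem _ (hyF _)
        (Submodule.smul_mem _ _ (hmono (not_lt.1 hlt) hlast))⟩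
  choose x hx0 hxj hxF using hx
  obtain ⟨h, hh, hhx, hhlast⟩ := exists_BCorner_mulVec_e (fun i j => hx0 j i) hxj
  refine ⟨h, hh, ?_⟩
  rw [hatFlag, smul_smul, smul_smul]
  refine smul_standardFlag_eq fun i => ?_
  obtain ⟨j, rfl⟩ := σ.symm.surjective i
  rw [Units.val_mul, Units.val_mul, ← mulVec_mulVec, ← mulVec_mulVec, permGL_mulVec_e,
    Equiv.apply_symm_apply, hatGL_mulVec, mulVec_add, mulVec_smul, hhlast]
  refine Fin.lastCases ?_ (fun j => ?_) j
  · rw [hhlast]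
    simpa [e] using hlast
  · have : ∑ i, T.indicator (1 : Fin m → ℂ) i * (e j.castSucc : Fin (m + 1) → ℂ) i.castSucc
        = T.indicator 1 j := by
      rw [Finset.sum_eq_single j]
      · simp [e]
      · intro i _ hij
        simp [e, hij]
      · simp
    rw [this, hhx]
    exact hxF j

/-! ### Orbits of the corner subgroup as intersections. -/

theorem orbit_BCorner_eq (F : FullFlag (m + 1)) :
    MulAction.orbit (BCorner m) F = MulAction.orbit (B m) F ∩ MulAction.orbit (BStar m) F := by
  apply Set.Subset.antisymm
  · rintro _ ⟨g, rfl⟩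
    exact ⟨⟨⟨g, BCorner_le_B g.2⟩, rfl⟩, ⟨⟨g, BCorner_le_BStar g.2⟩, rfl⟩⟩
  rintro F' ⟨⟨⟨b, hb⟩, rfl⟩, ⟨⟨b', hb'⟩, h⟩⟩
  obtain ⟨u, hu, -⟩ := existsUnique_starCell F
  rw [starCell_eq] at hu
  set σ := u * starPerm m
  obtain ⟨⟨a, ha⟩, rfl⟩ := MulAction.orbit_eq_iff.1 hu
  change b' • a • permGL σ • standardFlag (m + 1) = b • a • permGL σ • standardFlag (m + 1) at h
  change b • a • permGL σ • standardFlag (m + 1) ∈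
    MulAction.orbit (BCorner m) (a • permGL σ • standardFlag (m + 1))
  -- Both flags lie in one `BStar`-orbit, so the same σ serves for both normal forms.
  obtain ⟨T, hT, g, hg, hgF⟩ := exists_smul_hatFlag_eq σ ha
  obtain ⟨T', hT', g', hg', hgF'⟩ := exists_smul_hatFlag_eq σ (mul_mem hb' ha)
  rw [mul_smul, h, ← hgF] at hgF'
  have h1 : (g'⁻¹ * b * g) • hatFlag σ (T.indicator 1) = hatFlag σ (T'.indicator 1) := by
    rw [mul_smul, mul_smul, inv_smul_eq_iff, hgF']
  have hmem : g'⁻¹ * b * g ∈ B m :=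
    mul_mem (mul_mem (inv_mem (BCorner_le_B hg')) hb) (BCorner_le_B hg)
  have h2 : (g'⁻¹ * b * g)⁻¹ • hatFlag σ (T'.indicator 1) = hatFlag σ (T.indicator 1) := by
    rw [inv_smul_eq_iff, h1]
  have hTT : T = T' := (subset_of_smul_hatFlag_eq hT hmem h1).antisymm
    (subset_of_smul_hatFlag_eq hT' (inv_mem hmem) h2)
  subst hTT
  refine ⟨⟨g' * g⁻¹, mul_mem hg' (inv_mem hg)⟩, ?_⟩
  change (g' * g⁻¹) • a • permGL σ • standardFlag (m + 1) = _
  rw [← hgF, mul_smul, inv_smul_smul, hgF']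

theorem coe_smul_orbit {G X : Type*} [Group G] [MulAction G X] {H K : Subgroup G} (h : H ≤ K)
    (x : X) : (K : Set G) • MulAction.orbit H x = MulAction.orbit K x := by
  ext y
  constructor
  · rintro ⟨k, hk, _, ⟨g, rfl⟩, rfl⟩
    exact ⟨⟨k * g, mul_mem hk (h g.2)⟩, mul_smul _ _ _⟩
  · rintro ⟨k, rfl⟩
    exact ⟨k, k.2, x, MulAction.mem_orbit_self x, rfl⟩

end Shareshian

theorem theorem1p1 (m : ℕ) :
    (∀ F : FullFlag (m + 1), IsStandardForm F →
      MulAction.orbit (BCorner m) F = MulAction.orbit (B m) F ∩ MulAction.orbit (BStar m) F) ∧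
    (Set.range (fun Q : Orbits m => Q.orbit) =
      {S : Set (FullFlag (m + 1)) | S.Nonempty ∧
        ∃ F₁ F₂, S = MulAction.orbit (B m) F₁ ∩ MulAction.orbit (BStar m) F₂}) ∧
    (∃ Sh : Orbits m → Equiv.Perm (Fin (m + 1)) × Equiv.Perm (Fin (m + 1)),
      (∀ Q w u, Sh Q = (w, u) ↔
        (B m : Set (GL (Fin (m + 1)) ℂ)) • Q.orbit = schubertCell w ∧
        (BStar m : Set (GL (Fin (m + 1)) ℂ)) • Q.orbit = starCell u) ∧
      (∀ Q w u, Sh Q = (w, u) → Q.orbit = schubertCell w ∩ starCell u) ∧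
      Set.BijOn Sh Set.univ {p | (schubertCell p.1 ∩ starCell p.2).Nonempty}) := by
  refine ⟨fun F _ => orbit_BCorner_eq F, ?_, ?_⟩
  · ext S
    constructor
    · rintro ⟨Q, rfl⟩
      induction Q using Quotient.inductionOn with
      | _ F =>
        exact ⟨⟨F, MulAction.mem_orbit_self F⟩, F, F, orbit_BCorner_eq F⟩
    · rintro ⟨⟨F, hF⟩, F₁, F₂, rfl⟩
      refine ⟨Quotient.mk _ F, (orbit_BCorner_eq F).trans ?_⟩
      rw [MulAction.orbit_eq_iff.2 hF.1, MulAction.orbit_eq_iff.2 hF.2]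
  · have hex : ∀ Q : Orbits m, ∃ p : Equiv.Perm (Fin (m + 1)) × Equiv.Perm (Fin (m + 1)),
        ∀ w u, p = (w, u) ↔
        (B m : Set (GL (Fin (m + 1)) ℂ)) • Q.orbit = schubertCell w ∧
        (BStar m : Set (GL (Fin (m + 1)) ℂ)) • Q.orbit = starCell u := by
      intro Q
      induction Q using Quotient.inductionOn with
      | _ F =>
        obtain ⟨w, hw, hw'⟩ := existsUnique_schubertCell F
        obtain ⟨u, hu, hu'⟩ := existsUnique_starCell F
        refine ⟨(w, u), fun w₁ u₁ => ?_⟩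
        rw [MulAction.orbitRel.Quotient.orbit_mk, coe_smul_orbit BCorner_le_B,
          coe_smul_orbit BCorner_le_BStar]
        constructor
        · intro h
          obtain ⟨rfl, rfl⟩ := Prod.mk.inj h
          exact ⟨hw, hu⟩
        · rintro ⟨h1, h2⟩
          rw [hw' _ h1, hu' _ h2]
    choose Sh hSh using hex
    have horb : ∀ Q w u, Sh Q = (w, u) → Q.orbit = schubertCell w ∩ starCell u := by
      intro Q w u h
      obtain ⟨h1, h2⟩ := (hSh Q w u).1 h
      rw [← h1, ← h2]
      induction Q using Quotient.inductionOn with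
      | _ F =>
        rw [MulAction.orbitRel.Quotient.orbit_mk, coe_smul_orbit BCorner_le_B,
          coe_smul_orbit BCorner_le_BStar, orbit_BCorner_eq]
    refine ⟨Sh, hSh, horb, fun Q _ => ?_, fun Q _ Q' _ h => ?_, ?_⟩
    · change (schubertCell (Sh Q).1 ∩ starCell (Sh Q).2).Nonempty
      rw [← horb Q _ _ rfl]
      induction Q using Quotient.inductionOn with
      | _ F => exact ⟨F, MulAction.mem_orbit_self F⟩
    · refine MulAction.orbitRel.Quotient.orbit_injective ?_
      rw [horb Q _ _ rfl, horb Q' _ _ rfl, h]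
    · rintro ⟨w, u⟩ ⟨F, hw, hu⟩
      refine ⟨Quotient.mk _ F, Set.mem_univ _, (hSh _ w u).2 ?_⟩
      rw [MulAction.orbitRel.Quotient.orbit_mk, coe_smul_orbit BCorner_le_B,
        coe_smul_orbit BCorner_le_BStar]
      exact ⟨MulAction.orbit_eq_iff.2 hw, MulAction.orbit_eq_iff.2 hu⟩
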